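/- For a Borel probability measure $\nu$ on $\mathbb{R}$ and $c\in\mathbb{R}$, say that $\nu$ satisfies a logarithmic Sobolev inequality (LSI) with constant $c$ if for every nonnegative, locally absolutely continuous function $f:\mathbb{R}\to\mathbb{R}$ with $f,f'\in L^2(\nu)$ the entropy $$\mathrm{Ent}_\nu(f^2)=\int f^2\log\frac{f^2}{\int f^2\,d\nu}\,d\nu$$ is finite and satisfies $\mathrm{Ent}_\nu(f^2)\le c\int |f'|^2\,d\nu$. The optimal log-Sobolev constant of $\nu$ is the infimum of all such $c$ (and $+\infty$ if there are none). Let $R>0$ and $a>0$, and let $\mu$ be a Borel probability measure on $\mathbb{R}$ with $\mu(\mathbb{R}\setminus[-R,R])=0$ whose absolutely continuous part with respect to Lebesgue measure has a density that is at least $a$ almost everywhere on $[-R,R]$. For $\delta>0$ let $\gamma_\delta$ be the centered Gaussian measure of variance $\delta$, i.e. $d\gamma_\delta(t)=(2\pi\delta)^{-1/2}e^{-t^2/(2\delta)}\,dt$, and let $c(\delta)$ be the optimal log-Sobolev constant of the convolution $\mu*\gamma_\delta$. Then for all $0<\delta\le R^2$, $$c(\delta)\le 2067\,\frac{R}{a}+9016\,\delta+1248\,\delta\,\log\left(\frac{1}{a^2\delta}\right).$$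 -/

import Mathlib

open MeasureTheory

/-- The entropy functional `Ent_μ(g) = ∫ g log (g / ∫ g dμ) dμ`. -/
noncomputable def entropy (μ : Measure ℝ) (g : ℝ → ℝ) : ℝ :=
  ∫ x, g x * Real.log (g x / ∫ y, g y ∂μ) ∂μ

/-- The energy `ℰ(f, f) = ∫ |f'|² dμ`. -/
noncomputable def energy (μ : Measure ℝ) (f : ℝ → ℝ) : ℝ :=
  ∫ x, (deriv f x) ^ 2 ∂μ

/-- `μ` satisfies the logarithmic Sobolev inequality with constant `c`: for every nonnegative
locally absolutely continuous `f` with `f, f' ∈ L²(μ)`, the entropy of `f²` is finite (the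
integrand defining it is integrable) and `Ent_μ(f²) ≤ c ℰ(f, f)`. -/
def SatisfiesLSI (μ : Measure ℝ) (c : ℝ) : Prop :=
  ∀ f : ℝ → ℝ, (∀ x, 0 ≤ f x) →
    (∀ a b : ℝ, AbsolutelyContinuousOnInterval f a b) →
    Integrable (fun x => f x ^ 2) μ →
    Integrable (fun x => deriv f x ^ 2) μ →
    Integrable (fun x => f x ^ 2 * Real.log (f x ^ 2 / ∫ y, f y ^ 2 ∂μ)) μ ∧
      entropy μ (fun x => f x ^ 2) ≤ c * energy μ f

/-- The optimal log-Sobolev constant of `μ`: the infimum of all real constants with which `μ`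
satisfies the logarithmic Sobolev inequality (`⊤` if there is none). -/
noncomputable def optimalLSIConstant (μ : Measure ℝ) : EReal :=
  sInf ((fun c : ℝ => (c : EReal)) '' {c : ℝ | SatisfiesLSI μ c})

/-- `μ_δ = μ ∗ γ_δ`, the convolution of `μ` with the centered Gaussian of variance `δ`. -/
noncomputable def gaussianConvolution (μ : Measure ℝ) (δ : ℝ) : Measure ℝ :=
  μ.conv (ProbabilityTheory.gaussianReal 0 δ.toNNReal)

/-! The proof reduces the log-Sobolev inequality to a Hardy inequality with a logarithmic weight.
Let ν be the convolution, p its density, r = √δ, K = ∫ f² dν and h = log(e² + f²/K). A pointwise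
inequality (`exists_sq_mul_log_le`) bounds Ent(f²) by 5 ∫ (f - f(0))² h dν. All that is used of h
afterwards is ∫ eʰ dν ≤ e² + 1 ≤ 9.

On each half-line, Muckenhoupt's criterion (`weighted_hardy_inequality`) bounds ∫ (f - f(0))² h p by
4B ∫ f'² p as soon as φ(x) · ∫_x^∞ h p ≤ B for all x ≥ 0, where φ(x) = R/a + ∫_0^x 1/p. The product
is estimated in `lintegral_weight_le`. On [0, R] one has p ≥ a/5, so φ ≤ 6R/a, while the weighted
tail is at most 3. Beyond R, the density falls at least as fast as a Gaussian centred at R, because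
μ has no mass to the right of R. So the tail mass F and the integral of 1/p from R are governed by p
and 1/p at the same point, and these cancel in the product. Since ∫ eʰ p ≤ 9, the weight h costs
only a factor of order log(1/F) over F. The lower bound on p turns this into log(1/(a r)) plus a
quadratic term, which the decay of the product absorbs. -/

/-! ### Muckenhoupt's weighted Hardy inequality. -/

/-- The fundamental theorem of calculus for a nonnegative continuous derivative, as a Lebesgue
integral. -/
lemma lintegral_Icc_ofReal_deriv {g g' : ℝ → ℝ} {a b : ℝ} (hab : a ≤ b)
    (hg : ∀ x ∈ Set.Icc a b, HasDerivAt g (g' x) x) (hc : ContinuousOn g' (Set.Icc a b))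
    (h0 : ∀ x ∈ Set.Icc a b, 0 ≤ g' x) :
    ∫⁻ x in Set.Icc a b, ENNReal.ofReal (g' x) = ENNReal.ofReal (g b - g a) := by
  rw [← Set.uIcc_of_le hab] at hg hc
  rw [← intervalIntegral.integral_eq_sub_of_hasDerivAt hg hc.intervalIntegrable,
    intervalIntegral.integral_of_le hab, ← integral_Icc_eq_integral_Ioc,
    ofReal_integral_eq_lintegral_ofReal]
  · rw [Set.uIcc_of_le hab] at hc
    exact hc.integrableOn_Icc
  · exact (ae_restrict_iff' measurableSet_Icc).2 (ae_of_all _ h0)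

/-- By the change of variables for antitone functions the integral is the length of the image of g,
which lies in [0, g(y)]. No limit at infinity is needed. -/
lemma lintegral_Ici_ofReal_neg_deriv_le {g g' : ℝ → ℝ} {y : ℝ}
    (hg : ∀ x ∈ Set.Ici y, HasDerivWithinAt g (g' x) (Set.Ici y) x)
    (ha : AntitoneOn g (Set.Ici y)) (h0 : ∀ x ∈ Set.Ici y, 0 ≤ g x) :
    ∫⁻ x in Set.Ici y, ENNReal.ofReal (-g' x) ≤ ENNReal.ofReal (g y) := by
  rw [lintegral_deriv_eq_volume_image_of_antitoneOn measurableSet_Ici hg ha]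
  calc _ ≤ volume (Set.Icc 0 (g y)) := by
        apply measure_mono
        rintro _ ⟨t, ht, rfl⟩
        exact ⟨h0 t ht, ha Set.self_mem_Ici ht ht⟩
    _ = _ := by rw [Real.volume_Icc, sub_zero]

lemma lintegral_Icc_Ici_swap (F : ℝ → ℝ → ENNReal) (y : ℝ)
    (hF : Measurable (Function.uncurry F)) :
    ∫⁻ x in Set.Ici y, ∫⁻ t in Set.Icc y x, F x t =
      ∫⁻ t in Set.Ici y, ∫⁻ x in Set.Ici t, F x t := by
  have e1 : ∀ x ∈ Set.Ici y, ∫⁻ t in Set.Icc y x, F x t =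
      ∫⁻ t in Set.Ici y, (Set.Iic x).indicator (F x) t := by
    intro x _
    rw [lintegral_indicator measurableSet_Iic, Measure.restrict_restrict measurableSet_Iic,
      Set.inter_comm, Set.Ici_inter_Iic]
  have e2 : ∀ t ∈ Set.Ici y, ∫⁻ x in Set.Ici t, F x t =
      ∫⁻ x in Set.Ici y, (Set.Iic x).indicator (F x) t := by
    intro t ht
    have : ∀ x, (Set.Iic x).indicator (F x) t = (Set.Ici t).indicator (fun x => F x t) x := by
      intro x
      simp only [Set.indicator, Set.mem_Iic, Set.mem_Ici]
    simp only [this]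
    rw [lintegral_indicator measurableSet_Ici, Measure.restrict_restrict measurableSet_Ici,
      Set.inter_eq_left.2 (Set.Ici_subset_Ici.2 ht)]
  rw [setLIntegral_congr_fun measurableSet_Ici e1, setLIntegral_congr_fun measurableSet_Ici e2,
    lintegral_lintegral_swap]
  apply Measurable.aemeasurable
  have : (Function.uncurry fun x t => (Set.Iic x).indicator (F x) t) =
      {q : ℝ × ℝ | q.2 ≤ q.1}.indicator (Function.uncurry F) := by
    ext ⟨x, t⟩
    simp [Set.indicator]
  rw [this]
  exact hF.indicator (measurableSet_le measurable_snd measurable_fst)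

/-- If the tails of the weight `w` are at most `B / φ`, then `∫_y^∞ √φ w ≤ 2 B / √φ(y)`. -/
lemma lintegral_Ici_weight_mul_sqrt_le {p φ : ℝ → ℝ} {w : ℝ → ENNReal} {B : ℝ}
    (hp : Continuous p) (hp0 : ∀ x, 0 < p x) (hφ : ∀ x, HasDerivAt φ (p x)⁻¹ x)
    (hφ0 : ∀ x, 0 ≤ x → 0 < φ x) (hw : Measurable w) (hB : 0 ≤ B)
    (hW : ∀ x, 0 ≤ x → (∫⁻ t in Set.Ici x, w t) ≤ ENNReal.ofReal (B / φ x))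
    {y : ℝ} (hy : 0 ≤ y) :
    ∫⁻ x in Set.Ici y, w x * ENNReal.ofReal √(φ x) ≤ ENNReal.ofReal (2 * B / √(φ y)) := by
  have hφc : Continuous φ := continuous_iff_continuousAt.2 fun x => (hφ x).continuousAt
  have hpi : Continuous fun x => (p x)⁻¹ := hp.inv₀ fun x => (hp0 x).ne'
  have hder : ∀ x, 0 ≤ x → HasDerivAt (fun t => √(φ t)) ((p x)⁻¹ / (2 * √(φ x))) x :=
    fun x hx => (hφ x).sqrt (hφ0 x hx).ne'
  -- Write √φ(x) as √φ(y) plus the integral of its derivative, so that after Tonelli only tails of w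
  -- appear. Each of the two terms contributes B/√φ(y).
  have hsplit : ∀ x ∈ Set.Ici y, w x * ENNReal.ofReal √(φ x) =
      w x * ENNReal.ofReal √(φ y) +
        ∫⁻ t in Set.Icc y x, w x * ENNReal.ofReal ((p t)⁻¹ / (2 * √(φ t))) := by
    intro x hx
    have hx : y ≤ x := hx
    have hmono : √(φ y) ≤ √(φ x) := by
      apply Real.sqrt_le_sqrt
      exact monotone_of_hasDerivAt_nonneg hφ (fun x => (inv_pos.2 (hp0 x)).le) hx
    rw [lintegral_const_mul _ (by fun_prop), lintegral_Icc_ofReal_deriv (g := fun t => √(φ t)) hx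
      (fun t ht => hder t (hy.trans ht.1)), ← mul_add,
      ← ENNReal.ofReal_add (Real.sqrt_nonneg _) (by linarith)]
    · congr 2; ring
    · refine ContinuousOn.div hpi.continuousOn (by fun_prop) fun t ht => ?_
      have := Real.sqrt_pos.2 (hφ0 t (hy.trans ht.1))
      positivity
    · intro t ht
      have := hp0 t
      positivity
  rw [setLIntegral_congr_fun measurableSet_Ici hsplit, lintegral_add_left (by fun_prop),
    lintegral_mul_const _ hw, lintegral_Icc_Ici_swap _ _ (by fun_prop)]
  have h1 : (∫⁻ x in Set.Ici y, w x) * ENNReal.ofReal √(φ y) ≤ ENNReal.ofReal (B / √(φ y)) := by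
    refine (mul_le_mul_left (hW y hy) _).trans ?_
    rw [← ENNReal.ofReal_mul (div_nonneg hB (hφ0 y hy).le)]
    apply ENNReal.ofReal_le_ofReal
    have := hφ0 y hy
    rw [div_mul_eq_mul_div, mul_div_assoc, Real.sqrt_div_self, div_eq_mul_inv]
  have h2 : ∫⁻ t in Set.Ici y, ∫⁻ x in Set.Ici t,
      w x * ENNReal.ofReal ((p t)⁻¹ / (2 * √(φ t))) ≤ ENNReal.ofReal (B / √(φ y)) := by
    -- The tail bound B/φ times (√φ)' is exactly -(B/√φ)'.
    have hd : ∀ t ∈ Set.Ici y, HasDerivWithinAt (fun t => B / √(φ t))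
        (-(B * ((p t)⁻¹ / (2 * √(φ t))) / φ t)) (Set.Ici y) t := by
      intro t ht
      have ht0 := hφ0 t (hy.trans ht)
      have := (hasDerivAt_const t B).div (hder t (hy.trans ht)) (Real.sqrt_pos.2 ht0).ne'
      refine (this.congr_deriv ?_).hasDerivWithinAt
      rw [Real.sq_sqrt ht0.le]
      ring
    have hanti : AntitoneOn (fun t => B / √(φ t)) (Set.Ici y) := by
      intro s hs t ht hst
      have := Real.sqrt_pos.2 (hφ0 s (hy.trans hs))
      apply div_le_div_of_nonneg_left hB this
      exact Real.sqrt_le_sqrt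
        (monotone_of_hasDerivAt_nonneg hφ (fun x => (inv_pos.2 (hp0 x)).le) hst)
    calc _ ≤ ∫⁻ t in Set.Ici y,
          ENNReal.ofReal (-(-(B * ((p t)⁻¹ / (2 * √(φ t))) / φ t))) := by
          refine setLIntegral_mono (by fun_prop) fun t ht => ?_
          have ht0 := hφ0 t (hy.trans ht)
          rw [lintegral_mul_const _ hw]
          refine (mul_le_mul_left (hW t (hy.trans ht)) _).trans ?_
          rw [← ENNReal.ofReal_mul (div_nonneg hB ht0.le)]
          apply ENNReal.ofReal_le_ofReal
          rw [neg_neg]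
          apply le_of_eq
          ring
      _ ≤ _ := lintegral_Ici_ofReal_neg_deriv_le hd hanti fun t _ => by positivity
  refine (add_le_add h1 h2).trans ?_
  rw [← ENNReal.ofReal_add (by positivity) (by positivity)]
  apply le_of_eq
  congr 1
  ring

/-- **Muckenhoupt's weighted Hardy inequality** on the half-line. -/
theorem weighted_hardy_inequality {p φ v : ℝ → ℝ} {u w : ℝ → ENNReal} {B : ℝ}
    (hp : Continuous p) (hp0 : ∀ x, 0 < p x) (hφ : ∀ x, HasDerivAt φ (p x)⁻¹ x)
    (hφ0 : ∀ x, 0 ≤ x → 0 < φ x) (hw : Measurable w) (hB : 0 ≤ B)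
    (hW : ∀ x, 0 ≤ x → (∫⁻ t in Set.Ici x, w t) ≤ ENNReal.ofReal (B / φ x))
    (hv : Measurable v) (hu : ∀ x, 0 ≤ x → u x ≤ ∫⁻ t in Set.Icc 0 x, ENNReal.ofReal |v t|) :
    ∫⁻ x in Set.Ici 0, u x ^ 2 * w x ≤
      ENNReal.ofReal (4 * B) * ∫⁻ x in Set.Ici 0, ENNReal.ofReal (v x ^ 2 * p x) := by
  have hφc : Continuous φ := continuous_iff_continuousAt.2 fun x => (hφ x).continuousAt
  have hpi : Continuous fun x => (p x)⁻¹ := hp.inv₀ fun x => (hp0 x).ne'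
  set E : ℝ → ENNReal := fun t => ENNReal.ofReal (v t ^ 2 * p t * √(φ t)) with hE
  have hEm : Measurable E := by fun_prop
  -- Cauchy–Schwarz with the auxiliary weight p√φ. The dual integral is ∫ φ'/√φ = 2√φ(x) - 2√φ(0).
  have hcs : ∀ x, 0 ≤ x →
      u x ^ 2 ≤ (∫⁻ t in Set.Icc 0 x, E t) * (2 * ENNReal.ofReal √(φ x)) := by
    intro x hx
    set α : ℝ → ENNReal := fun t => ENNReal.ofReal (|v t| * √(p t * √(φ t)))
    set β : ℝ → ENNReal := fun t => ENNReal.ofReal (√(p t * √(φ t)))⁻¹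
    have h1 : ∫⁻ t in Set.Icc 0 x, ENNReal.ofReal |v t| = ∫⁻ t in Set.Icc 0 x, (α * β) t := by
      refine setLIntegral_congr_fun measurableSet_Icc fun t ht => ?_
      have h := hp0 t
      have h' := hφ0 t ht.1
      simp only [α, β, Pi.mul_apply]
      rw [← ENNReal.ofReal_mul (by positivity), mul_assoc, mul_inv_cancel₀ (by positivity),
        mul_one]
    have h2 : ∫⁻ t in Set.Icc 0 x, α t ^ (2 : ℝ) = ∫⁻ t in Set.Icc 0 x, E t := by
      refine setLIntegral_congr_fun measurableSet_Icc fun t ht => ?_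
      have h := hp0 t
      simp only [α, E]
      rw [ENNReal.rpow_two, ← ENNReal.ofReal_pow (by positivity), mul_pow, sq_abs,
        Real.sq_sqrt (by positivity), mul_assoc]
    have h3 : ∫⁻ t in Set.Icc 0 x, β t ^ (2 : ℝ) ≤ 2 * ENNReal.ofReal √(φ x) := by
      have e : ∫⁻ t in Set.Icc 0 x, β t ^ (2 : ℝ) =
          ∫⁻ t in Set.Icc 0 x, ENNReal.ofReal (2 * ((p t)⁻¹ / (2 * √(φ t)))) := by
        refine setLIntegral_congr_fun measurableSet_Icc fun t ht => ?_
        have h := hp0 t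
        have h' := hφ0 t ht.1
        simp only [β]
        rw [ENNReal.rpow_two, ← ENNReal.ofReal_pow (by positivity), inv_pow,
          Real.sq_sqrt (by positivity)]
        congr 1
        field_simp
      rw [e, lintegral_Icc_ofReal_deriv (g := fun t => 2 * √(φ t)) hx]
      · rw [show (2 : ENNReal) = ENNReal.ofReal 2 by simp, ← ENNReal.ofReal_mul (by norm_num)]
        apply ENNReal.ofReal_le_ofReal
        have := Real.sqrt_nonneg (φ 0)
        linarith
      · exact fun t ht => ((hφ t).sqrt (hφ0 t ht.1).ne').const_mul 2
      · refine ContinuousOn.mul continuousOn_const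
          (ContinuousOn.div hpi.continuousOn (by fun_prop) fun t ht => ?_)
        have := Real.sqrt_pos.2 (hφ0 t ht.1)
        positivity
      · intro t ht
        have := hp0 t
        positivity
    have h4 := ENNReal.lintegral_mul_le_Lp_mul_Lq (volume.restrict (Set.Icc 0 x))
      Real.HolderConjugate.two_two (f := α) (g := β) (by fun_prop) (by fun_prop)
    rw [← h1, h2] at h4
    calc u x ^ 2 ≤ ((∫⁻ t in Set.Icc 0 x, E t) ^ (1 / 2 : ℝ) *
          (∫⁻ t in Set.Icc 0 x, β t ^ (2 : ℝ)) ^ (1 / 2 : ℝ)) ^ 2 := by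
          gcongr
          exact (hu x hx).trans h4
      _ = (∫⁻ t in Set.Icc 0 x, E t) * ∫⁻ t in Set.Icc 0 x, β t ^ (2 : ℝ) := by
          rw [mul_pow, ← ENNReal.rpow_two, ← ENNReal.rpow_two, ← ENNReal.rpow_mul,
            ← ENNReal.rpow_mul]
          norm_num
      _ ≤ _ := by gcongr
  calc ∫⁻ x in Set.Ici 0, u x ^ 2 * w x
      ≤ ∫⁻ x in Set.Ici 0, ∫⁻ t in Set.Icc 0 x,
          E t * (2 * (w x * ENNReal.ofReal √(φ x))) := by
        refine setLIntegral_mono' measurableSet_Ici fun x hx => ?_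
        rw [lintegral_mul_const _ hEm]
        refine (mul_le_mul_left (hcs x hx) _).trans (le_of_eq ?_)
        ring
    _ = ∫⁻ t in Set.Ici 0, ∫⁻ x in Set.Ici t, E t * (2 * (w x * ENNReal.ofReal √(φ x))) :=
        lintegral_Icc_Ici_swap _ _ (by fun_prop)
    _ ≤ ∫⁻ t in Set.Ici 0, ENNReal.ofReal (4 * B) * ENNReal.ofReal (v t ^ 2 * p t) := by
        refine setLIntegral_mono' measurableSet_Ici fun t ht => ?_
        have ht : 0 ≤ t := ht
        rw [lintegral_const_mul _ (by fun_prop), lintegral_const_mul _ (by fun_prop)]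
        refine (mul_le_mul_right (mul_le_mul_right
          (lintegral_Ici_weight_mul_sqrt_le hp hp0 hφ hφ0 hw hB hW ht) _) _).trans ?_
        have h := hp0 t
        have h' := Real.sqrt_pos.2 (hφ0 t ht)
        simp only [E]
        rw [show (2 : ENNReal) = ENNReal.ofReal 2 by simp, ← ENNReal.ofReal_mul (by norm_num),
          ← ENNReal.ofReal_mul (by positivity), ← ENNReal.ofReal_mul (by positivity)]
        apply ENNReal.ofReal_le_ofReal
        apply le_of_eq
        field_simp
        ring
    _ = _ := lintegral_const_mul _ (by fun_prop)

/-! ### Pointwise comparison of the entropy with a weighted square. -/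

lemma two_le_log_exp_two_add {x : ℝ} (hx : 0 ≤ x) : 2 ≤ Real.log (Real.exp 2 + x) := by
  rw [Real.le_log_iff_exp_le (by positivity)]
  linarith

/-- The left side vanishes to second order at s = 1. For s ≤ 4, log s ≤ s - 1 bounds it by (2s +
1)(s - 1)² ≤ 9(s - 1)², and the logarithm on the right is at least 2. For s > 4, s² ≤ 2(s - 1)² and
log s² is at most twice that logarithm. -/
lemma sq_mul_log_sub_le {s : ℝ} (hs : 0 ≤ s) :
    s ^ 2 * Real.log (s ^ 2) - s ^ 2 + 1 ≤
      5 * (s - 1) ^ 2 * Real.log (Real.exp 2 + s ^ 2 / 4) := by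
  have hA := two_le_log_exp_two_add (x := s ^ 2 / 4) (by positivity)
  rcases le_or_gt s 4 with h | h
  · have h2 : s ^ 2 * Real.log (s ^ 2) ≤ s ^ 2 * (2 * (s - 1)) := by
      rcases hs.eq_or_lt with rfl | hs0
      · simp
      · have := Real.log_le_sub_one_of_pos hs0
        rw [Real.log_pow]
        refine mul_le_mul_of_nonneg_left ?_ (sq_nonneg s)
        push_cast
        linarith
    nlinarith [mul_le_mul_of_nonneg_left hA (sq_nonneg (s - 1)),
      mul_nonneg (sq_nonneg (s - 1)) (sub_nonneg.2 h)]
  · have h1 : Real.log (s ^ 2) ≤ 2 * Real.log (Real.exp 2 + s ^ 2 / 4) := by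
      have e : s ^ 2 = 4 * (s ^ 2 / 4) := by ring
      have h4 : Real.log 4 ≤ 2 := by
        have : (4 : ℝ) = 2 ^ 2 := by norm_num
        rw [this, Real.log_pow]
        have := Real.log_two_lt_d9
        push_cast
        linarith
      have : Real.log (s ^ 2 / 4) ≤ Real.log (Real.exp 2 + s ^ 2 / 4) :=
        Real.log_le_log (by positivity) (by linarith [Real.exp_pos 2])
      conv_lhs => rw [e, Real.log_mul (by norm_num) (by positivity)]
      linarith
    have h2 : s ^ 2 ≤ 2 * (s - 1) ^ 2 := by nlinarith
    set H := Real.log (Real.exp 2 + s ^ 2 / 4)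
    have h3 : s ^ 2 * Real.log (s ^ 2) ≤ (2 * (s - 1) ^ 2) * (2 * H) :=
      (mul_le_mul_of_nonneg_left h1 (by positivity)).trans
        (mul_le_mul_of_nonneg_right h2 (by linarith))
    nlinarith [mul_nonneg (sq_nonneg (s - 1)) (by linarith : 0 ≤ H)]

/-- Up to a term `α f² + β` of nonpositive integral, the integrand of `Ent(f²)` is controlled by
`(f - c)²` times a logarithmic weight. -/
lemma exists_sq_mul_log_le {K c : ℝ} (hK : 0 < K) (hc : 0 ≤ c) :
    ∃ α β : ℝ, α * K + β ≤ 0 ∧ ∀ y : ℝ, 0 ≤ y → y ^ 2 * Real.log (y ^ 2 / K) ≤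
      5 * ((y - c) ^ 2 * Real.log (Real.exp 2 + y ^ 2 / K)) + α * y ^ 2 + β := by
  rcases le_or_gt (K / 4) (c ^ 2) with h | h
  · have hc0 : 0 < c := by
      rcases hc.eq_or_lt with rfl | h0
      · exfalso; norm_num at h; linarith
      · exact h0
    -- These come from the variational bound Ent(f²) ≤ ∫ (f² log(f²/c²) - f² + c²). The condition on
    -- α and β is log t ≤ t - 1 at t = c²/K, and K ≤ 4c² accounts for the 1/4 in
    -- `sq_mul_log_sub_le`.
    refine ⟨1 + Real.log (c ^ 2 / K), -c ^ 2, ?_, fun y hy => ?_⟩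
    · have := Real.log_le_sub_one_of_pos (x := c ^ 2 / K) (by positivity)
      have h2 := mul_le_mul_of_nonneg_right this hK.le
      rw [sub_mul, div_mul_cancel₀ _ hK.ne'] at h2
      linarith
    · have h1 := sq_mul_log_sub_le (s := y / c) (by positivity)
      have h2 := mul_le_mul_of_nonneg_left h1 (sq_nonneg c)
      have h3 : Real.log (Real.exp 2 + (y / c) ^ 2 / 4) ≤ Real.log (Real.exp 2 + y ^ 2 / K) := by
        apply Real.log_le_log (by positivity)
        gcongr _ + ?_
        rw [div_pow, div_div]
        gcongr
        linarith
      have e1 : c ^ 2 * ((y / c) ^ 2 * Real.log ((y / c) ^ 2) - (y / c) ^ 2 + 1) =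
          y ^ 2 * Real.log ((y / c) ^ 2) - y ^ 2 + c ^ 2 := by
        field_simp
      have e2 : c ^ 2 * (5 * (y / c - 1) ^ 2 * Real.log (Real.exp 2 + (y / c) ^ 2 / 4)) =
          5 * ((y - c) ^ 2 * Real.log (Real.exp 2 + (y / c) ^ 2 / 4)) := by
        rw [show y - c = c * (y / c - 1) by field_simp]
        ring
      have e3 : y ^ 2 * Real.log (y ^ 2 / K) =
          y ^ 2 * Real.log ((y / c) ^ 2) + y ^ 2 * Real.log (c ^ 2 / K) := by
        rcases hy.eq_or_lt with rfl | hy0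
        · simp
        · rw [← mul_add, ← Real.log_mul (by positivity) (by positivity)]
          congr 2
          field_simp
      rw [e1, e2] at h2
      have h4 := mul_le_mul_of_nonneg_left h3 (sq_nonneg (y - c))
      rw [e3]
      linarith
  -- Here c < √K/2. Where y² ≤ K the left side is nonpositive; otherwise y > 2c, so y and y - c are
  -- comparable.
  · refine ⟨0, 0, by simp, fun y hy => ?_⟩
    have hA := two_le_log_exp_two_add (x := y ^ 2 / K) (by positivity)
    rw [zero_mul, add_zero, add_zero]
    rcases le_or_gt (y ^ 2) K with h1 | h1
    · have : Real.log (y ^ 2 / K) ≤ 0 :=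
        Real.log_nonpos (by positivity) ((div_le_one hK).2 h1)
      have : y ^ 2 * Real.log (y ^ 2 / K) ≤ 0 := mul_nonpos_of_nonneg_of_nonpos (sq_nonneg y) this
      have : 0 ≤ (y - c) ^ 2 * Real.log (Real.exp 2 + y ^ 2 / K) := by positivity
      linarith
    · have hyc : 2 * c < y := by
        apply lt_of_pow_lt_pow_left₀ 2 hy
        nlinarith
      have h2 : y ^ 2 ≤ 5 * (y - c) ^ 2 := by nlinarith
      have hy0 : 0 < y := by linarith
      have h3 : Real.log (y ^ 2 / K) ≤ Real.log (Real.exp 2 + y ^ 2 / K) :=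
        Real.log_le_log (by positivity) (by linarith [Real.exp_pos 2])
      calc _ ≤ y ^ 2 * Real.log (Real.exp 2 + y ^ 2 / K) := by gcongr
        _ ≤ 5 * (y - c) ^ 2 * Real.log (Real.exp 2 + y ^ 2 / K) := by gcongr
        _ = _ := by ring

/-! ### Tail estimates and Hardy constants for the mollified density. -/

/-- The tail entropy bound: a function with `∫ eʰ ≤ M` has small integral over sets of small
measure. -/
lemma lintegral_mul_le_of_lintegral_exp_le {α : Type*} [MeasurableSpace α] {m : Measure α}
    {h p : α → ℝ} {M F l : ℝ} (hh : Measurable h) (hp : Measurable p) (hp0 : ∀ x, 0 ≤ p x)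
    (hM : ∫⁻ x, ENNReal.ofReal (Real.exp (h x) * p x) ∂m ≤ ENNReal.ofReal M)
    (hF : ∫⁻ x, ENNReal.ofReal (p x) ∂m ≤ ENNReal.ofReal F) (hl : 1 ≤ l) (hM0 : 0 ≤ M)
    (hF0 : 0 ≤ F) :
    ∫⁻ x, ENNReal.ofReal (h x * p x) ∂m ≤
      ENNReal.ofReal (F * (l - 1) + M * Real.exp (-l)) := by
  calc _ ≤ ∫⁻ x, (ENNReal.ofReal (p x) * ENNReal.ofReal (l - 1) +
        ENNReal.ofReal (Real.exp (h x) * p x) * ENNReal.ofReal (Real.exp (-l))) ∂m := by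
        refine lintegral_mono fun x => ?_
        rw [← ENNReal.ofReal_mul (hp0 x), ← ENNReal.ofReal_mul (by have := hp0 x; positivity),
          ← ENNReal.ofReal_add (mul_nonneg (hp0 x) (by linarith)) (by have := hp0 x; positivity)]
        apply ENNReal.ofReal_le_ofReal
        -- Young's inequality h ≤ (l - 1) + exp(h - l). The level l is free and is later adapted to
        -- the tail mass.
        have h1 := Real.add_one_le_exp (h x - l)
        rw [sub_eq_add_neg, Real.exp_add] at h1
        nlinarith [mul_le_mul_of_nonneg_right h1 (hp0 x)]
    _ = (∫⁻ x, ENNReal.ofReal (p x) ∂m) * ENNReal.ofReal (l - 1) +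
        (∫⁻ x, ENNReal.ofReal (Real.exp (h x) * p x) ∂m) * ENNReal.ofReal (Real.exp (-l)) := by
        rw [lintegral_add_left (by fun_prop), lintegral_mul_const _ (by fun_prop),
          lintegral_mul_const _ (by fun_prop)]
    _ ≤ ENNReal.ofReal F * ENNReal.ofReal (l - 1) +
        ENNReal.ofReal M * ENNReal.ofReal (Real.exp (-l)) := by gcongr
    _ = _ := by
        rw [← ENNReal.ofReal_mul hF0, ← ENNReal.ofReal_mul hM0,
          ← ENNReal.ofReal_add (mul_nonneg hF0 (by linarith)) (by positivity)]

/-- The properties on `[0, ∞)` of the density of the convolution of a measure on `[-R, R]` with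
the centered Gaussian of variance `r²` that control its weighted Hardy constants. -/
structure IsMollifiedDensity (p : ℝ → ℝ) (R a r : ℝ) : Prop where
  continuous : Continuous p
  pos : ∀ x, 0 < p x
  lower_bulk : ∀ x ∈ Set.Icc 0 R, a / 5 ≤ p x
  lower_tail : ∀ s, 0 ≤ s → a / 5 * Real.exp (-((s + r) ^ 2 / (2 * r ^ 2))) ≤ p (R + s)
  decay : ∀ s t, 0 ≤ s → s ≤ t →
    p (R + t) * Real.exp (t ^ 2 / (2 * r ^ 2)) ≤ p (R + s) * Real.exp (s ^ 2 / (2 * r ^ 2))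
  mass : ∫⁻ x in Set.Ici 0, ENNReal.ofReal (p x) ≤ 1

namespace IsMollifiedDensity

variable {p : ℝ → ℝ} {R a r : ℝ}

/-- The Gaussian exponent -t²/(2r²) given by `decay` lies below its tangent at t = s + r, which
leaves an exponential to integrate. This choice of tangent point gives a bound that is uniform down
to s = 0. -/
lemma lintegral_tail_le (H : IsMollifiedDensity p R a r) (hr : 0 < r) {s : ℝ} (hs : 0 ≤ s) :
    ∫⁻ x in Set.Ici (R + s), ENNReal.ofReal (p x) ≤
      ENNReal.ofReal (p (R + s) * (Real.exp (1 / 2) * (r ^ 2 / (r + s)))) := by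
  have hp := H.pos (R + s)
  set C := p (R + s) * Real.exp (1 / 2)
  set k := (r + s) / r ^ 2
  have hC : 0 < C := by positivity
  have hk : 0 < k := by positivity
  have hd : ∀ x, HasDerivAt (fun x => C / k * Real.exp (-k * (x - (R + s))))
      (-(C * Real.exp (-k * (x - (R + s))))) x := by
    intro x
    have h1 : HasDerivAt (fun x => -k * (x - (R + s))) (-k * 1) x :=
      ((hasDerivAt_id x).sub_const _).const_mul _
    refine (h1.exp.const_mul (C / k)).congr_deriv ?_
    field_simp
  calc _ ≤ ∫⁻ x in Set.Ici (R + s),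
        ENNReal.ofReal (-(-(C * Real.exp (-k * (x - (R + s)))))) := by
        refine setLIntegral_mono' measurableSet_Ici fun x hx => ?_
        have hx : R + s ≤ x := hx
        apply ENNReal.ofReal_le_ofReal
        rw [neg_neg]
        have h1 := H.decay s (x - R) hs (by linarith)
        rw [show R + (x - R) = x by ring] at h1
        have h2 : p x ≤ p (R + s) *
            Real.exp (s ^ 2 / (2 * r ^ 2) - (x - R) ^ 2 / (2 * r ^ 2)) := by
          rw [Real.exp_sub, ← mul_div_assoc, le_div_iff₀ (Real.exp_pos _)]
          exact h1
        refine h2.trans ?_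
        simp only [C]
        rw [mul_assoc, ← Real.exp_add]
        gcongr
        simp only [k]
        rw [← sub_nonneg]
        have : 1 / 2 + -((r + s) / r ^ 2) * (x - (R + s)) -
            (s ^ 2 / (2 * r ^ 2) - (x - R) ^ 2 / (2 * r ^ 2)) =
            (x - (R + s) - r) ^ 2 / (2 * r ^ 2) := by
          field_simp
          ring
        rw [this]
        positivity
    _ ≤ ENNReal.ofReal (C / k * Real.exp (-k * (R + s - (R + s)))) :=
        lintegral_Ici_ofReal_neg_deriv_le (fun x _ => (hd x).hasDerivWithinAt)
          ((antitone_of_hasDerivAt_nonpos hd fun x =>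
            neg_nonpos.2 (by positivity)).antitoneOn _)
          fun x _ => by positivity
    _ = _ := by
        rw [sub_self, mul_zero, Real.exp_zero, mul_one]
        congr 1
        simp only [C, k]
        field_simp

/-- The exponent of the bound on 1/p is convex, so no tangent dominates it. A line of slope (r +
s)/(4r²), raised by 1/2 at the endpoint R + s, does so on the whole interval. -/
lemma integral_inv_le (H : IsMollifiedDensity p R a r) (hr : 0 < r) {s : ℝ} (hs : 0 ≤ s) :
    ∫ x in R..(R + s), (p x)⁻¹ ≤
      (p (R + s))⁻¹ * (Real.exp (1 / 2) * (4 * (r ^ 2 / (r + s)))) := by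
  have hp := H.pos (R + s)
  have hpi : Continuous fun x => (p x)⁻¹ := H.continuous.inv₀ fun x => (H.pos x).ne'
  set C := (p (R + s))⁻¹ * Real.exp (1 / 2)
  set k := (r + s) / (4 * r ^ 2)
  have hC : 0 < C := by positivity
  have hk : 0 < k := by positivity
  have hd : ∀ x, HasDerivAt (fun x => C / k * Real.exp (k * (x - (R + s))))
      (C * Real.exp (k * (x - (R + s)))) x := by
    intro x
    have h1 : HasDerivAt (fun x => k * (x - (R + s))) (k * 1) x :=
      ((hasDerivAt_id x).sub_const _).const_mul _
    refine (h1.exp.const_mul (C / k)).congr_deriv ?_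
    field_simp
  have hcont : Continuous fun x => C * Real.exp (k * (x - (R + s))) := by fun_prop
  calc _ ≤ ∫ x in R..(R + s), C * Real.exp (k * (x - (R + s))) := by
        refine intervalIntegral.integral_mono_on (by linarith) (hpi.intervalIntegrable _ _)
          (hcont.intervalIntegrable _ _) fun x hx => ?_
        have h1 := H.decay (x - R) s (by linarith [hx.1]) (by linarith [hx.2])
        rw [show R + (x - R) = x by ring] at h1
        have hx0 := H.pos x
        have h2 : (p x)⁻¹ ≤ (p (R + s))⁻¹ *
            Real.exp ((x - R) ^ 2 / (2 * r ^ 2) - s ^ 2 / (2 * r ^ 2)) := by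
          rw [Real.exp_sub, inv_mul_eq_div, inv_eq_one_div, div_div, div_le_div_iff₀ hx0
            (by positivity)]
          linarith
        refine h2.trans ?_
        simp only [C]
        rw [mul_assoc, ← Real.exp_add]
        gcongr
        simp only [k]
        rw [← sub_nonneg]
        have : 1 / 2 + (r + s) / (4 * r ^ 2) * (x - (R + s)) -
            ((x - R) ^ 2 / (2 * r ^ 2) - s ^ 2 / (2 * r ^ 2)) =
            (2 * r ^ 2 - r * (R + s - x) + 3 * s * (R + s - x) - 2 * (R + s - x) ^ 2)
              / (4 * r ^ 2) := by
          field_simp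
          ring
        rw [this]
        apply div_nonneg _ (by positivity)
        have hz : 0 ≤ R + s - x := by linarith [hx.2]
        have hz' : 0 ≤ s - (R + s - x) := by linarith [hx.1]
        nlinarith [mul_nonneg hz hz', sq_nonneg (R + s - x - r), sq_nonneg (R + s - x), sq_nonneg r]
    _ = C / k * Real.exp (k * (R + s - (R + s))) - C / k * Real.exp (k * (R - (R + s))) :=
        intervalIntegral.integral_eq_sub_of_hasDerivAt (fun x _ => hd x)
          (hcont.intervalIntegrable _ _)
    _ ≤ C / k * Real.exp (k * (R + s - (R + s))) := sub_le_self _ (by positivity)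
    _ = _ := by
        rw [sub_self, mul_zero, Real.exp_zero, mul_one]
        simp only [C, k]
        field_simp

/-- Only the mass within distance r of R + s is kept. The bound limits how large the level l must be
for 9 exp(-l) to be at most the tail mass. -/
lemma le_lintegral_tail (H : IsMollifiedDensity p R a r) (ha : 0 < a) (hr : 0 < r) {s : ℝ}
    (hs : 0 ≤ s) :
    ENNReal.ofReal (r * (a / 5 * Real.exp (-((s + 2 * r) ^ 2 / (2 * r ^ 2))))) ≤
      ∫⁻ x in Set.Ici (R + s), ENNReal.ofReal (p x) := by
  calc _ = ∫⁻ _ in Set.Icc (R + s) (R + s + r),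
        ENNReal.ofReal (a / 5 * Real.exp (-((s + 2 * r) ^ 2 / (2 * r ^ 2)))) := by
        rw [setLIntegral_const, Real.volume_Icc, ← ENNReal.ofReal_mul (by positivity)]
        congr 1
        ring
    _ ≤ ∫⁻ x in Set.Icc (R + s) (R + s + r), ENNReal.ofReal (p x) := by
        refine setLIntegral_mono' measurableSet_Icc fun x hx => ?_
        apply ENNReal.ofReal_le_ofReal
        have h := H.lower_tail (x - R) (by linarith [hx.1])
        rw [show R + (x - R) = x by ring] at h
        refine le_trans ?_ h
        have : (x - R + r) ^ 2 ≤ (s + 2 * r) ^ 2 :=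
          pow_le_pow_left₀ (by linarith [hx.1]) (by linarith [hx.2]) 2
        gcongr
    _ ≤ _ := lintegral_mono_set Set.Icc_subset_Ici_self

lemma integral_inv_bulk_le (H : IsMollifiedDensity p R a r) (ha : 0 < a) {x : ℝ}
    (hx : x ∈ Set.Icc 0 R) : ∫ t in (0 : ℝ)..x, (p t)⁻¹ ≤ 5 * (R / a) := by
  have hpi : Continuous fun x => (p x)⁻¹ := H.continuous.inv₀ fun x => (H.pos x).ne'
  calc _ ≤ ∫ _ in (0 : ℝ)..x, (a / 5)⁻¹ := by
        refine intervalIntegral.integral_mono_on hx.1 (hpi.intervalIntegrable _ _)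
          (by simp) fun t ht => ?_
        exact inv_anti₀ (by positivity) (H.lower_bulk t ⟨ht.1, ht.2.trans hx.2⟩)
    _ = 5 * (x / a) := by
        rw [intervalIntegral.integral_const, smul_eq_mul]
        field_simp
        ring
    _ ≤ _ := by
        gcongr
        exact hx.2

/-- This is the hypothesis of Muckenhoupt's criterion for the weight h p. The bulk gives 18R/a; the
remaining terms come from the part of ∫ 1/p beyond R. -/
lemma lintegral_weight_le (H : IsMollifiedDensity p R a r) (ha : 0 < a) (hR : 0 < R)
    (hr : 0 < r) (hL : 0 ≤ Real.log (1 / (a * r))) {h : ℝ → ℝ} (hh : Measurable h)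
    (hexp : ∫⁻ x in Set.Ici 0, ENNReal.ofReal (Real.exp (h x) * p x) ≤ ENNReal.ofReal 9)
    {x : ℝ} (hx : 0 ≤ x) :
    ∫⁻ t in Set.Ici x, ENNReal.ofReal (h t * p t) ≤
      ENNReal.ofReal ((18 * (R / a) + 66 * r ^ 2 + 11 * r ^ 2 * Real.log (1 / (a * r))) /
        (R / a + ∫ t in (0 : ℝ)..x, (p t)⁻¹)) := by
  have hpi : Continuous fun x => (p x)⁻¹ := H.continuous.inv₀ fun x => (H.pos x).ne'
  have hi0 : ∀ b c : ℝ, b ≤ c → 0 ≤ ∫ t in b..c, (p t)⁻¹ := fun b c hbc =>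
    intervalIntegral.integral_nonneg hbc fun t _ => (inv_pos.2 (H.pos t)).le
  have hRa : 0 < R / a := by positivity
  set L := Real.log (1 / (a * r)) with hLdef
  have hexp' : ∫⁻ t in Set.Ici x, ENNReal.ofReal (Real.exp (h t) * p t) ≤ ENNReal.ofReal 9 :=
    (lintegral_mono_set (Set.Ici_subset_Ici.2 hx)).trans hexp
  have hmass : ∫⁻ t in Set.Ici x, ENNReal.ofReal (p t) ≤ ENNReal.ofReal 1 := by
    rw [ENNReal.ofReal_one]
    exact (lintegral_mono_set (Set.Ici_subset_Ici.2 hx)).trans H.mass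
  have hW3 : ∫⁻ t in Set.Ici x, ENNReal.ofReal (h t * p t) ≤ ENNReal.ofReal 3 := by
    refine (lintegral_mul_le_of_lintegral_exp_le hh H.continuous.measurable
      (fun t => (H.pos t).le) hexp' hmass (l := 3) (by norm_num) (by norm_num)
      (by norm_num)).trans (ENNReal.ofReal_le_ofReal ?_)
    have h9 : (9 : ℝ) ≤ Real.exp 3 := by
      have := Real.exp_one_gt_d9
      rw [show (3 : ℝ) = ((3 : ℕ) : ℝ) * 1 by norm_num, Real.exp_nat_mul]
      calc (9 : ℝ) ≤ 2.7 ^ 3 := by norm_num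
        _ ≤ _ := by gcongr; linarith
    have : 9 * Real.exp (-3) ≤ 1 := by
      rw [Real.exp_neg, ← div_eq_mul_inv, div_le_one (Real.exp_pos _)]
      exact h9
    linarith
  rcases le_or_gt x R with hxR | hxR
  -- In the bulk R/a + ∫ 1/p ≤ 6R/a, and 3 · 6 = 18.
  · refine hW3.trans (ENNReal.ofReal_le_ofReal ?_)
    have h1 := H.integral_inv_bulk_le ha ⟨hx, hxR⟩
    have h2 := hi0 0 x hx
    rw [le_div_iff₀ (by positivity)]
    nlinarith [mul_nonneg (sq_nonneg r) hL, sq_nonneg r]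
  · obtain ⟨s, hs, rfl⟩ : ∃ s, 0 ≤ s ∧ x = R + s := ⟨x - R, by linarith, by ring⟩
    set F := (∫⁻ t in Set.Ici (R + s), ENNReal.ofReal (p t)).toReal with hF
    have hFe : ∫⁻ t in Set.Ici (R + s), ENNReal.ofReal (p t) = ENNReal.ofReal F :=
      (ENNReal.ofReal_toReal (ne_top_of_le_ne_top ENNReal.ofReal_ne_top hmass)).symm
    have hF0 : 0 ≤ F := ENNReal.toReal_nonneg
    have hFu := H.lintegral_tail_le hr hs
    have hpx := H.pos (R + s)
    rw [hFe, ENNReal.ofReal_le_ofReal_iff (by positivity)] at hFu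
    have hFl := H.le_lintegral_tail ha hr hs
    rw [hFe, ENNReal.ofReal_le_ofReal_iff hF0] at hFl
    set q := (s + 2 * r) ^ 2 / (2 * r ^ 2) with hq
    have hq0 : 0 ≤ q := by positivity
    have h45 : (45 : ℝ) ≤ Real.exp 4 := by
      have := Real.exp_one_gt_d9
      rw [show (4 : ℝ) = ((4 : ℕ) : ℝ) * 1 by norm_num, Real.exp_nat_mul]
      calc (45 : ℝ) ≤ 2.7 ^ 4 := by norm_num
        _ ≤ _ := by gcongr; linarith
    -- The level l = 4 + L + q matches the lower bound r(a/5)exp(-q) for F: exp(-L) = a r, and e⁴ ≥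
    -- 45 = 9 · 5. Then the tail entropy bound becomes W ≤ F l.
    have hl : 9 * Real.exp (-(4 + L + q)) ≤ F := by
      refine le_trans ?_ hFl
      have e : Real.exp (-(4 + L + q)) = (Real.exp 4)⁻¹ * (a * r) * Real.exp (-q) := by
        rw [show -(4 + L + q) = -4 + -L + -q by ring, Real.exp_add, Real.exp_add, Real.exp_neg 4,
          Real.exp_neg L, hLdef, Real.exp_log (by positivity), one_div, inv_inv]
      have : (Real.exp 4)⁻¹ ≤ 45⁻¹ := inv_anti₀ (by norm_num) h45
      rw [e]
      calc 9 * ((Real.exp 4)⁻¹ * (a * r) * Real.exp (-q))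
          ≤ 9 * (45⁻¹ * (a * r) * Real.exp (-q)) := by gcongr
        _ = _ := by ring
    have hWl := lintegral_mul_le_of_lintegral_exp_le hh H.continuous.measurable
      (fun t => (H.pos t).le) hexp' hFe.le (l := 4 + L + q) (by linarith) (by norm_num) hF0
    set W := (∫⁻ t in Set.Ici (R + s), ENNReal.ofReal (h t * p t)).toReal with hWdef
    have hWe : ∫⁻ t in Set.Ici (R + s), ENNReal.ofReal (h t * p t) = ENNReal.ofReal W :=
      (ENNReal.ofReal_toReal (ne_top_of_le_ne_top ENNReal.ofReal_ne_top hW3)).symm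
    have hW0 : 0 ≤ W := ENNReal.toReal_nonneg
    rw [hWe] at hW3 hWl ⊢
    rw [ENNReal.ofReal_le_ofReal_iff (by norm_num)] at hW3
    have hFq : 0 ≤ F * (4 + L + q - 1) := mul_nonneg hF0 (by linarith)
    rw [ENNReal.ofReal_le_ofReal_iff (by positivity)] at hWl
    have hWF : W ≤ F * (4 + L + q) := by linarith
    apply ENNReal.ofReal_le_ofReal
    have hI1 := H.integral_inv_bulk_le ha (x := R) ⟨hR.le, le_rfl⟩
    have hI2 := H.integral_inv_le hr hs
    rw [← intervalIntegral.integral_add_adjacent_intervals (hpi.intervalIntegrable 0 R)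
      (hpi.intervalIntegrable R (R + s))]
    have hI10 := hi0 0 R hR.le
    have hI20 := hi0 R (R + s) (by linarith)
    set I1 := ∫ t in (0 : ℝ)..R, (p t)⁻¹
    set I2 := ∫ t in R..(R + s), (p t)⁻¹
    rw [le_div_iff₀ (by positivity)]
    -- The values of p and 1/p at R + s cancel, leaving 4e ≤ 11.
    have hFI : F * I2 ≤ 11 * (r ^ 2 / (r + s)) ^ 2 := by
      calc F * I2 ≤ (p (R + s) * (Real.exp (1 / 2) * (r ^ 2 / (r + s)))) *
            ((p (R + s))⁻¹ * (Real.exp (1 / 2) * (4 * (r ^ 2 / (r + s))))) := by gcongr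
        _ = 4 * (Real.exp (1 / 2) * Real.exp (1 / 2)) * (r ^ 2 / (r + s)) ^ 2 := by
          field_simp
        _ ≤ _ := by
          rw [← Real.exp_add]
          gcongr
          have := Real.exp_one_lt_d9
          norm_num at this ⊢
          linarith
    have hr1 : (r ^ 2 / (r + s)) ^ 2 ≤ r ^ 2 := by
      gcongr
      rw [div_le_iff₀ (by positivity)]
      nlinarith
    -- The quadratic growth of q in s is exactly compensated by (r + s)⁻².
    have hr2 : (r ^ 2 / (r + s)) ^ 2 * q ≤ 2 * r ^ 2 := by
      have : (r ^ 2 / (r + s)) ^ 2 * q = r ^ 2 * ((s + 2 * r) / (r + s)) ^ 2 / 2 := by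
        rw [hq]
        field_simp
      rw [this]
      have h2 : ((s + 2 * r) / (r + s)) ^ 2 ≤ 2 ^ 2 := by
        gcongr
        rw [div_le_iff₀ (by positivity)]
        linarith
      nlinarith [sq_nonneg r]
    have hWI1 : W * (R / a + I1) ≤ 18 * (R / a) := by
      calc W * (R / a + I1) ≤ 3 * (R / a + 5 * (R / a)) := by gcongr
        _ = _ := by ring
    have hWI2 : W * I2 ≤ 66 * r ^ 2 + 11 * r ^ 2 * L := by
      calc W * I2 ≤ F * (4 + L + q) * I2 := by gcongr
        _ = F * I2 * (4 + L + q) := by ring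
        _ ≤ 11 * (r ^ 2 / (r + s)) ^ 2 * (4 + L + q) := by gcongr
        _ = 11 * ((r ^ 2 / (r + s)) ^ 2 * (4 + L) + (r ^ 2 / (r + s)) ^ 2 * q) := by ring
        _ ≤ 11 * (r ^ 2 * (4 + L) + 2 * r ^ 2) := by gcongr
        _ = _ := by ring
    linarith

/-- A logarithmically weighted Hardy inequality on the half-line. -/
theorem lintegral_sq_mul_weight_le (H : IsMollifiedDensity p R a r) (ha : 0 < a) (hR : 0 < R)
    (hr : 0 < r) (hL : 0 ≤ Real.log (1 / (a * r))) {h : ℝ → ℝ} (hh : Measurable h)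
    (hexp : ∫⁻ x in Set.Ici 0, ENNReal.ofReal (Real.exp (h x) * p x) ≤ ENNReal.ofReal 9)
    {u : ℝ → ENNReal} {v : ℝ → ℝ} (hv : Measurable v)
    (hu : ∀ x, 0 ≤ x → u x ≤ ∫⁻ t in Set.Icc 0 x, ENNReal.ofReal |v t|) :
    ∫⁻ x in Set.Ici 0, u x ^ 2 * ENNReal.ofReal (h x * p x) ≤
      ENNReal.ofReal (4 * (18 * (R / a) + 66 * r ^ 2 + 11 * r ^ 2 * Real.log (1 / (a * r)))) *
        ∫⁻ x in Set.Ici 0, ENNReal.ofReal (v x ^ 2 * p x) := by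
  have hpi : Continuous fun x => (p x)⁻¹ := H.continuous.inv₀ fun x => (H.pos x).ne'
  have hpm := H.continuous.measurable
  refine weighted_hardy_inequality H.continuous H.pos
    -- The offset R/a keeps φ positive at 0 and is of the same order as the bulk integral of 1/p.
    (φ := fun x => R / a + ∫ t in (0 : ℝ)..x, (p t)⁻¹) (fun x => ?_) (fun x hx => ?_)
    (by fun_prop) (by positivity) (fun x hx => H.lintegral_weight_le ha hR hr hL hh hexp hx) hv hu
  · exact (intervalIntegral.integral_hasDerivAt_right (hpi.intervalIntegrable _ _)
      (hpi.stronglyMeasurableAtFilter _ _) hpi.continuousAt).const_add _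
  · have := intervalIntegral.integral_nonneg (μ := volume) hx
      fun t _ => (inv_pos.2 (H.pos t)).le
    positivity

end IsMollifiedDensity

/-! ### Gaussian mollification and its density. -/

/-- The density of the centered Gaussian of variance `r²`. -/
noncomputable def gaussianKernel (r z : ℝ) : ℝ :=
  (√(2 * Real.pi) * r)⁻¹ * Real.exp (-(z ^ 2 / (2 * r ^ 2)))

/-- The density of the convolution of `μ` with the centered Gaussian of variance `r²`. -/
noncomputable def mollifiedDensity (μ : Measure ℝ) (r x : ℝ) : ℝ :=
  ∫ t, gaussianKernel r (x - t) ∂μ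

lemma gaussianPDFReal_toNNReal {δ : ℝ} (hδ : 0 < δ) (z : ℝ) :
    ProbabilityTheory.gaussianPDFReal 0 δ.toNNReal z = gaussianKernel √δ z := by
  rw [ProbabilityTheory.gaussianPDFReal, gaussianKernel, Real.sq_sqrt hδ.le,
    Real.coe_toNNReal _ hδ.le, Real.sqrt_mul (by positivity), sub_zero, neg_div]

lemma continuous_gaussianKernel (r : ℝ) : Continuous (gaussianKernel r) := by
  unfold gaussianKernel
  fun_prop

lemma gaussianKernel_pos {r : ℝ} (hr : 0 < r) (z : ℝ) : 0 < gaussianKernel r z := by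
  unfold gaussianKernel
  positivity

lemma gaussianKernel_le {r : ℝ} (hr : 0 < r) (z : ℝ) :
    gaussianKernel r z ≤ (√(2 * Real.pi) * r)⁻¹ := by
  unfold gaussianKernel
  apply mul_le_of_le_one_right (by positivity)
  rw [Real.exp_le_one_iff, neg_nonpos]
  positivity

lemma gaussianKernel_neg (r z : ℝ) : gaussianKernel r (-z) = gaussianKernel r z := by
  simp [gaussianKernel]

lemma integrable_gaussianKernel_sub (μ : Measure ℝ) [IsFiniteMeasure μ] {r : ℝ} (hr : 0 < r)
    (x : ℝ) : Integrable (fun t => gaussianKernel r (x - t)) μ := by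
  refine Integrable.of_bound (C := (√(2 * Real.pi) * r)⁻¹)
    ((continuous_gaussianKernel r).comp (by fun_prop)).aestronglyMeasurable (ae_of_all _ fun t => ?_)
  rw [Real.norm_of_nonneg (gaussianKernel_pos hr _).le]
  exact gaussianKernel_le hr _

lemma ofReal_mollifiedDensity (μ : Measure ℝ) [IsFiniteMeasure μ] {r : ℝ} (hr : 0 < r) (x : ℝ) :
    ENNReal.ofReal (mollifiedDensity μ r x) =
      ∫⁻ t, ENNReal.ofReal (gaussianKernel r (x - t)) ∂μ :=
  ofReal_integral_eq_lintegral_ofReal (integrable_gaussianKernel_sub μ hr x)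
    (ae_of_all _ fun _ => (gaussianKernel_pos hr _).le)

lemma continuous_mollifiedDensity (μ : Measure ℝ) [IsFiniteMeasure μ] {r : ℝ} (hr : 0 < r) :
    Continuous (mollifiedDensity μ r) := by
  unfold mollifiedDensity
  refine continuous_of_dominated (bound := fun _ => (√(2 * Real.pi) * r)⁻¹)
    (fun x => ((continuous_gaussianKernel r).comp (by fun_prop)).aestronglyMeasurable)
    (fun x => ae_of_all _ fun t => ?_) (integrable_const _)
    (ae_of_all _ fun t => (continuous_gaussianKernel r).comp (by fun_prop))
  rw [Real.norm_of_nonneg (gaussianKernel_pos hr _).le]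
  exact gaussianKernel_le hr _

lemma gaussianConvolution_eq_withDensity (μ : Measure ℝ) [IsFiniteMeasure μ] {δ : ℝ}
    (hδ : 0 < δ) : gaussianConvolution μ δ =
      volume.withDensity fun x => ENNReal.ofReal (mollifiedDensity μ √δ x) := by
  have hv : δ.toNNReal ≠ 0 := by simpa using hδ
  have hr := Real.sqrt_pos.2 hδ
  have hk := continuous_gaussianKernel √δ
  have hk' := hk.measurable
  have hc := (continuous_mollifiedDensity μ hr).measurable
  refine Measure.ext_of_lintegral _ fun g hg => ?_
  rw [gaussianConvolution, Measure.lintegral_conv hg,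
    lintegral_withDensity_eq_lintegral_mul _ (by fun_prop) hg,
    ProbabilityTheory.gaussianReal_of_var_ne_zero _ hv]
  have e : ∀ t, ∫⁻ y, g (t + y)
      ∂(volume.withDensity (ProbabilityTheory.gaussianPDF 0 δ.toNNReal)) =
      ∫⁻ x, ENNReal.ofReal (gaussianKernel √δ (x - t)) * g x := by
    intro t
    rw [lintegral_withDensity_eq_lintegral_mul _ (ProbabilityTheory.measurable_gaussianPDF _ _)
      (by fun_prop), ← lintegral_add_left_eq_self
        (fun x => ENNReal.ofReal (gaussianKernel √δ (x - t)) * g x) t]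
    refine lintegral_congr fun y => ?_
    rw [Pi.mul_apply, ProbabilityTheory.gaussianPDF, gaussianPDFReal_toNNReal hδ,
      add_sub_cancel_left]
  simp_rw [e]
  rw [lintegral_lintegral_swap (by fun_prop)]
  refine lintegral_congr fun x => ?_
  rw [lintegral_mul_const _ (by fun_prop), Pi.mul_apply, ofReal_mollifiedDensity μ hr]

lemma mollifiedDensity_map_neg (μ : Measure ℝ) (r x : ℝ) :
    mollifiedDensity (μ.map Neg.neg) r x = mollifiedDensity μ r (-x) := by
  have hm : Continuous fun t => gaussianKernel r (x - t) :=
    (continuous_gaussianKernel r).comp (by fun_prop)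
  rw [mollifiedDensity, mollifiedDensity, integral_map measurable_neg.aemeasurable
    hm.aestronglyMeasurable]
  congr 1
  ext t
  rw [← gaussianKernel_neg]
  congr 1
  ring

/-- Near an interval where `μ` dominates `a` times Lebesgue measure, the mollified density is
bounded below. -/
lemma le_mollifiedDensity {μ : Measure ℝ} [IsFiniteMeasure μ] {R a r x c m : ℝ} (ha : 0 < a)
    (hr : 0 < r) (hμ : ENNReal.ofReal a • volume.restrict (Set.Icc (-R) R) ≤ μ)
    (hc : Set.Icc c (c + r) ⊆ Set.Icc (-R) R) (hm : ∀ t ∈ Set.Icc c (c + r), (x - t) ^ 2 ≤ m ^ 2) :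
    a * (√(2 * Real.pi))⁻¹ * Real.exp (-(m ^ 2 / (2 * r ^ 2))) ≤ mollifiedDensity μ r x := by
  have h0 : 0 ≤ mollifiedDensity μ r x := integral_nonneg fun t => (gaussianKernel_pos hr _).le
  rw [← ENNReal.ofReal_le_ofReal_iff h0, ofReal_mollifiedDensity μ hr]
  calc _ = ENNReal.ofReal a * ∫⁻ _ in Set.Icc c (c + r), ENNReal.ofReal (gaussianKernel r m) := by
        rw [setLIntegral_const, Real.volume_Icc,
          ← ENNReal.ofReal_mul (gaussianKernel_pos hr _).le, ← ENNReal.ofReal_mul ha.le,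
          gaussianKernel]
        congr 1
        field_simp
        ring
    _ ≤ ENNReal.ofReal a * ∫⁻ t in Set.Icc c (c + r),
          ENNReal.ofReal (gaussianKernel r (x - t)) := by
        refine mul_le_mul_right (setLIntegral_mono' measurableSet_Icc fun t ht => ?_) _
        apply ENNReal.ofReal_le_ofReal
        unfold gaussianKernel
        have := hm t ht
        gcongr
    _ ≤ ENNReal.ofReal a * ∫⁻ t in Set.Icc (-R) R, ENNReal.ofReal (gaussianKernel r (x - t)) := by
        gcongr
    _ = ∫⁻ t, ENNReal.ofReal (gaussianKernel r (x - t))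
          ∂(ENNReal.ofReal a • volume.restrict (Set.Icc (-R) R)) := by
        rw [lintegral_smul_measure, smul_eq_mul]
    _ ≤ _ := lintegral_mono' hμ le_rfl

lemma isMollifiedDensity_mollifiedDensity {μ : Measure ℝ} [IsProbabilityMeasure μ] {R a r : ℝ}
    (ha : 0 < a) (hr : 0 < r) (hrR : r ≤ R) (hsupp : μ (Set.Icc (-R) R)ᶜ = 0)
    (hμ : ENNReal.ofReal a • volume.restrict (Set.Icc (-R) R) ≤ μ) :
    IsMollifiedDensity (mollifiedDensity μ r) R a r := by
  have hπ : 0 < √(2 * Real.pi) := by positivity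
  -- Source of the 5 in a/5: a window of length r within distance r of x contributes at least
  -- a/√(2πe).
  have hπe : √(2 * Real.pi) * Real.exp (1 / 2) ≤ 5 := by
    apply le_of_sq_le_sq _ (by norm_num)
    rw [mul_pow, Real.sq_sqrt (by positivity), ← Real.exp_nat_mul]
    have h1 := Real.exp_one_lt_d9
    have h2 := Real.pi_lt_d2
    have h3 := Real.pi_pos
    norm_num
    nlinarith [Real.exp_pos 1]
  have hπ5 : √(2 * Real.pi) ≤ 5 := by
    have := Real.one_le_exp (x := 1 / 2) (by norm_num)
    nlinarith
  constructor
  · exact continuous_mollifiedDensity μ hr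
  · intro x
    rw [mollifiedDensity, integral_pos_iff_support_of_nonneg
      (fun t => (gaussianKernel_pos hr _).le) (integrable_gaussianKernel_sub μ hr x)]
    have : Function.support (fun t => gaussianKernel r (x - t)) = Set.univ :=
      Set.eq_univ_of_forall fun t => (gaussianKernel_pos hr _).ne'
    rw [this, measure_univ]
    norm_num
  · intro x hx
    -- The window [x - r, x] stays inside [-R, R] because r ≤ R.
    refine le_trans ?_ (le_mollifiedDensity (x := x) (c := x - r) (m := r) ha hr hμ
      (Set.Icc_subset_Icc (by linarith [hx.1]) (by linarith [hx.2])) fun t ht => ?_)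
    · have : r ^ 2 / (2 * r ^ 2) = 1 / 2 := by field_simp
      rw [this, mul_assoc, Real.exp_neg, ← mul_inv, div_eq_mul_inv]
      gcongr
    · have h1 : 0 ≤ x - t := by linarith [ht.2]
      have h2 : x - t ≤ r := by linarith [ht.1]
      gcongr
  · intro s hs
    refine le_trans ?_ (le_mollifiedDensity (x := R + s) (c := R - r) (m := s + r) ha hr hμ
      (Set.Icc_subset_Icc (by linarith) (by linarith)) fun t ht => ?_)
    · rw [div_eq_mul_inv]
      gcongr
    · have h1 : 0 ≤ R + s - t := by linarith [ht.2]
      have h2 : R + s - t ≤ s + r := by linarith [ht.1]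
      gcongr
  · intro s t hs hst
    rw [mollifiedDensity, mollifiedDensity, ← integral_mul_const, ← integral_mul_const]
    refine integral_mono_ae ((integrable_gaussianKernel_sub μ hr _).mul_const _)
      ((integrable_gaussianKernel_sub μ hr _).mul_const _) ?_
    filter_upwards [mem_ae_iff.2 hsupp] with y hy
    unfold gaussianKernel
    rw [mul_assoc, mul_assoc, ← Real.exp_add, ← Real.exp_add]
    gcongr (√(2 * Real.pi) * r)⁻¹ * Real.exp ?_
    -- The z² terms cancel, and what remains is nonincreasing in z since y ≤ R for almost every y.
    have e : ∀ z, -((R + z - y) ^ 2 / (2 * r ^ 2)) + z ^ 2 / (2 * r ^ 2) =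
        -(((R - y) ^ 2 + 2 * z * (R - y)) / (2 * r ^ 2)) := by
      intro z
      ring
    rw [e, e]
    have : 0 ≤ R - y := by linarith [hy.2]
    gcongr
  · calc _ ≤ ∫⁻ x, ENNReal.ofReal (mollifiedDensity μ r x) := setLIntegral_le_lintegral _ _
      _ = gaussianConvolution μ (r ^ 2) Set.univ := by
          rw [gaussianConvolution_eq_withDensity μ (by positivity), Real.sqrt_sq hr.le,
            withDensity_apply _ MeasurableSet.univ, Measure.restrict_univ]
      _ ≤ 1 := by
          unfold gaussianConvolution
          exact prob_le_one

lemma smul_volume_restrict_le_of_rnDeriv {μ : Measure ℝ} {s : Set ℝ} {a : ENNReal}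
    (hs : MeasurableSet s) (h : ∀ᵐ x ∂(volume.restrict s), a ≤ μ.rnDeriv volume x) :
    a • volume.restrict s ≤ μ :=
  calc a • volume.restrict s = (volume.restrict s).withDensity fun _ => a :=
        (withDensity_const a).symm
    _ ≤ (volume.restrict s).withDensity (μ.rnDeriv volume) := withDensity_mono h
    _ = (volume.withDensity (μ.rnDeriv volume)).restrict s := (restrict_withDensity hs _).symm
    _ ≤ volume.withDensity (μ.rnDeriv volume) := Measure.restrict_le_self
    _ ≤ μ := Measure.withDensity_rnDeriv_le μ volume

lemma smul_volume_restrict_le_map_neg {μ : Measure ℝ} {R : ℝ} {a : ENNReal}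
    (h : a • volume.restrict (Set.Icc (-R) R) ≤ μ) :
    a • volume.restrict (Set.Icc (-R) R) ≤ μ.map Neg.neg := by
  have e : (volume.restrict (Set.Icc (-R) R)).map Neg.neg = volume.restrict (Set.Icc (-R) R) := by
    have := (Measure.measurePreserving_neg (volume : Measure ℝ)).restrict_preimage
      (s := Set.Icc (-R) R) measurableSet_Icc
    have hpre : Neg.neg ⁻¹' Set.Icc (-R) R = Set.Icc (-R) R := by
      ext x
      simp only [Set.mem_preimage, Set.mem_Icc]
      constructor <;> rintro ⟨h1, h2⟩ <;> constructor <;> linarith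
    rw [hpre] at this
    exact this.map_eq
  have := Measure.map_mono h measurable_neg
  rwa [Measure.map_smul, e] at this

/-! ### From the half-lines to the log-Sobolev inequality on the line. -/

lemma lintegral_eq_add_lintegral_comp_neg (F : ℝ → ENNReal) :
    ∫⁻ x, F x = (∫⁻ x in Set.Ici 0, F x) + ∫⁻ x in Set.Ici 0, F (-x) := by
  have h := (Measure.measurePreserving_neg (volume : Measure ℝ)).setLIntegral_comp_preimage_emb
    (MeasurableEquiv.neg ℝ).measurableEmbedding F (Set.Iic 0)
  have hpre : Neg.neg ⁻¹' Set.Iic (0 : ℝ) = Set.Ici 0 := by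
    ext x
    simp
  rw [hpre] at h
  rw [h, ← setLIntegral_congr Iio_ae_eq_Iic, ← Set.compl_Ici,
    lintegral_add_compl _ measurableSet_Ici]

lemma continuous_of_forall_absolutelyContinuousOnInterval {f : ℝ → ℝ}
    (hf : ∀ a b : ℝ, AbsolutelyContinuousOnInterval f a b) : Continuous f :=
  continuous_iff_continuousAt.2 fun x =>
    ((hf (x - 1) (x + 1)).continuousOn).continuousAt (by
      rw [Set.uIcc_of_le (by linarith)]
      exact Icc_mem_nhds (by linarith) (by linarith))

lemma AbsolutelyContinuousOnInterval.ofReal_abs_sub_le {f : ℝ → ℝ} {a b : ℝ} (hab : a ≤ b)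
    (hf : AbsolutelyContinuousOnInterval f a b) :
    ENNReal.ofReal |f b - f a| ≤ ∫⁻ t in Set.Icc a b, ENNReal.ofReal |deriv f t| := by
  rw [← hf.integral_deriv_eq_sub, intervalIntegral.integral_of_le hab,
    ← integral_Icc_eq_integral_Ioc]
  simp only [← Real.norm_eq_abs, ofReal_norm]
  exact enorm_integral_le_lintegral_enorm _

lemma ofReal_abs_comp_neg_sub_le {f : ℝ → ℝ}
    (hf : ∀ a b : ℝ, AbsolutelyContinuousOnInterval f a b) {x : ℝ} (hx : 0 ≤ x) :
    ENNReal.ofReal |f (-x) - f 0| ≤ ∫⁻ t in Set.Icc 0 x, ENNReal.ofReal |deriv f (-t)| := by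
  have h := (hf (-x) 0).ofReal_abs_sub_le (by linarith)
  rw [abs_sub_comm]
  refine h.trans (le_of_eq ?_)
  have h := (Measure.measurePreserving_neg (volume : Measure ℝ)).setLIntegral_comp_preimage_emb
    (MeasurableEquiv.neg ℝ).measurableEmbedding
    (fun t => ENNReal.ofReal |deriv f t|) (Set.Icc (-x) 0)
  have hpre : Neg.neg ⁻¹' Set.Icc (-x) 0 = Set.Icc 0 x := by
    ext y
    simp only [Set.mem_preimage, Set.mem_Icc]
    constructor <;> rintro ⟨h1, h2⟩ <;> constructor <;> linarith
  rw [hpre] at h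
  exact h.symm

/-- The weighted Hardy inequality on the whole line. -/
lemma lintegral_sq_sub_mul_weight_le {p : ℝ → ℝ} {R a r : ℝ} (H : IsMollifiedDensity p R a r)
    (H' : IsMollifiedDensity (fun x => p (-x)) R a r) (ha : 0 < a) (hR : 0 < R)
    (hr : 0 < r) (hL : 0 ≤ Real.log (1 / (a * r))) {h : ℝ → ℝ} (hh : Measurable h)
    (hexp : ∫⁻ x, ENNReal.ofReal (Real.exp (h x) * p x) ≤ ENNReal.ofReal 9)
    {f : ℝ → ℝ} (hf : ∀ a b : ℝ, AbsolutelyContinuousOnInterval f a b) :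
    ∫⁻ x, ENNReal.ofReal ((f x - f 0) ^ 2 * h x * p x) ≤
      ENNReal.ofReal (4 * (18 * (R / a) + 66 * r ^ 2 + 11 * r ^ 2 * Real.log (1 / (a * r)))) *
        ∫⁻ x, ENNReal.ofReal (deriv f x ^ 2 * p x) := by
  have hd := measurable_deriv f
  have e : ∀ x, ENNReal.ofReal ((f x - f 0) ^ 2 * h x * p x) =
      ENNReal.ofReal |f x - f 0| ^ 2 * ENNReal.ofReal (h x * p x) := by
    intro x
    rw [← ENNReal.ofReal_pow (abs_nonneg _), sq_abs, ← ENNReal.ofReal_mul (sq_nonneg _), mul_assoc]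
  have hexp1 := (setLIntegral_le_lintegral (Set.Ici 0) _).trans hexp
  have hexp2 : ∫⁻ x in Set.Ici 0, ENNReal.ofReal (Real.exp (h (-x)) * p (-x)) ≤
      ENNReal.ofReal 9 := by
    rw [lintegral_eq_add_lintegral_comp_neg] at hexp
    exact le_add_self.trans hexp
  simp_rw [e]
  rw [lintegral_eq_add_lintegral_comp_neg,
    lintegral_eq_add_lintegral_comp_neg (fun x => ENNReal.ofReal (deriv f x ^ 2 * p x)), mul_add]
  exact add_le_add
    (H.lintegral_sq_mul_weight_le ha hR hr hL hh hexp1 hd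
      fun x hx => (hf 0 x).ofReal_abs_sub_le hx)
    (H'.lintegral_sq_mul_weight_le ha hR hr hL (h := fun x => h (-x)) (by fun_prop) hexp2
      (v := fun x => deriv f (-x)) (by fun_prop) fun x hx => ofReal_abs_comp_neg_sub_le hf hx)

lemma neg_le_mul_log_div {y K : ℝ} (hy : 0 ≤ y) (hK : 0 < K) : -K ≤ y * Real.log (y / K) := by
  rcases hy.eq_or_lt with rfl | hy0
  · simpa using hK.le
  · have h := Real.one_sub_inv_le_log_of_pos (x := y / K) (by positivity)
    have h2 := mul_le_mul_of_nonneg_left h hy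
    have e : y * (1 - (y / K)⁻¹) = y - K := by field_simp
    linarith

/-- A logarithmically weighted Hardy inequality implies a logarithmic Sobolev inequality. -/
theorem satisfiesLSI_of_weighted_hardy {ν : Measure ℝ} [IsProbabilityMeasure ν] {C : ℝ}
    (hC : 0 ≤ C)
    (H : ∀ f h : ℝ → ℝ, (∀ a b : ℝ, AbsolutelyContinuousOnInterval f a b) → Measurable h →
      ∫⁻ x, ENNReal.ofReal (Real.exp (h x)) ∂ν ≤ ENNReal.ofReal 9 →
      ∫⁻ x, ENNReal.ofReal ((f x - f 0) ^ 2 * h x) ∂ν ≤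
        ENNReal.ofReal C * ∫⁻ x, ENNReal.ofReal (deriv f x ^ 2) ∂ν) :
    SatisfiesLSI ν (5 * C) := by
  intro f hf0 hfac hf2 hfd
  have hen : 0 ≤ energy ν f := integral_nonneg fun x => sq_nonneg _
  have hfc := continuous_of_forall_absolutelyContinuousOnInterval hfac
  set K := ∫ y, f y ^ 2 ∂ν with hK
  have hK0 : 0 ≤ K := integral_nonneg fun x => sq_nonneg _
  unfold entropy
  simp only
  rw [← hK]
  rcases hK0.eq_or_lt with hK1 | hKpos
  -- If K = 0, division by zero and log 0 = 0 make the entropy integrand vanish identically.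
  · simp only [← hK1, div_zero, Real.log_zero, mul_zero]
    exact ⟨integrable_zero _ _ _, by rw [integral_zero]; positivity⟩
  -- With this weight ∫ eʰ dν = e² + 1 ≤ 9.
  set h : ℝ → ℝ := fun x => Real.log (Real.exp 2 + f x ^ 2 / K) with hh
  have hpos : ∀ x, 0 < Real.exp 2 + f x ^ 2 / K := fun x => by positivity
  have hhc : Continuous h := Continuous.log (by fun_prop) fun x => (hpos x).ne'
  have h0 : ∀ x, 0 ≤ h x := fun x => by
    have := two_le_log_exp_two_add (x := f x ^ 2 / K) (by positivity)
    linarith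
  have hexp : ∫⁻ x, ENNReal.ofReal (Real.exp (h x)) ∂ν ≤ ENNReal.ofReal 9 := by
    simp only [hh, Real.exp_log (hpos _)]
    have hi : Integrable (fun x => Real.exp 2 + f x ^ 2 / K) ν :=
      (integrable_const _).add (hf2.div_const K)
    rw [← ofReal_integral_eq_lintegral_ofReal hi (ae_of_all _ fun x => (hpos x).le),
      integral_add (integrable_const _) (hf2.div_const K),
      integral_div, ← hK, div_self hKpos.ne']
    apply ENNReal.ofReal_le_ofReal
    have := Real.exp_one_lt_d9
    have e : Real.exp 2 = Real.exp 1 ^ 2 := by rw [← Real.exp_nat_mul]; norm_num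
    simp only [integral_const, probReal_univ, one_smul]
    rw [e]
    nlinarith [Real.exp_pos 1]
  have hH := H f h hfac hhc.measurable hexp
  set D : ℝ → ℝ := fun x => (f x - f 0) ^ 2 * h x with hD
  have hD0 : ∀ x, 0 ≤ D x := fun x => mul_nonneg (sq_nonneg _) (h0 x)
  have hDc : Continuous D := by fun_prop
  rw [← ofReal_integral_eq_lintegral_ofReal hfd (ae_of_all _ fun x => sq_nonneg _),
    ← ENNReal.ofReal_mul hC] at hH
  have hDi : Integrable D ν := by
    refine ⟨hDc.aestronglyMeasurable, ?_⟩
    rw [hasFiniteIntegral_iff_ofReal (ae_of_all _ hD0)]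
    exact hH.trans_lt ENNReal.ofReal_lt_top
  have hDle : ∫ x, D x ∂ν ≤ C * energy ν f := by
    rw [← ofReal_integral_eq_lintegral_ofReal hDi (ae_of_all _ hD0),
      ← energy, ENNReal.ofReal_le_ofReal_iff (mul_nonneg hC hen)] at hH
    exact hH
  obtain ⟨α, β, hαβ, hle⟩ := exists_sq_mul_log_le hKpos (hf0 0)
  have hDfi : Integrable (fun x => 5 * D x + α * f x ^ 2) ν :=
    (hDi.const_mul 5).add (hf2.const_mul α)
  have hbi : Integrable (fun x => 5 * D x + α * f x ^ 2 + β) ν := hDfi.add (integrable_const β)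
  have hle' : ∀ x, f x ^ 2 * Real.log (f x ^ 2 / K) ≤ 5 * D x + α * f x ^ 2 + β :=
    fun x => hle (f x) (hf0 x)
  have hint : Integrable (fun x => f x ^ 2 * Real.log (f x ^ 2 / K)) ν := by
    have hm := hfc.measurable
    exact integrable_of_le_of_le (Measurable.aestronglyMeasurable (by fun_prop))
      (ae_of_all _ fun x => neg_le_mul_log_div (sq_nonneg (f x)) hKpos) (ae_of_all _ hle')
      (integrable_const _) hbi
  refine ⟨hint, ?_⟩
  calc _ ≤ ∫ x, (5 * D x + α * f x ^ 2 + β) ∂ν := integral_mono hint hbi hle'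
    _ = 5 * ∫ x, D x ∂ν + (α * K + β) := by
        rw [integral_add hDfi (integrable_const β),
          integral_add (hDi.const_mul 5) (hf2.const_mul α), integral_const_mul,
          integral_const_mul, ← hK]
        simp only [integral_const, probReal_univ, one_smul]
        ring
    _ ≤ _ := by linarith

/-! ### Assembly and constants. -/

theorem mainTheorem6 (μ : Measure ℝ) [IsProbabilityMeasure μ] (R a δ : ℝ)
    (hR : 0 < R) (ha : 0 < a)
    (hsupp : μ (Set.Icc (-R) R)ᶜ = 0)
    (hdens : ∀ᵐ x ∂(volume.restrict (Set.Icc (-R) R)),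
      ENNReal.ofReal a ≤ μ.rnDeriv volume x)
    (hδ : 0 < δ) (hδR : δ ≤ R ^ 2) :
    optimalLSIConstant (gaussianConvolution μ δ) ≤
      ((2067 * (R / a) + 9016 * δ + 1248 * δ * Real.log (1 / (a ^ 2 * δ)) : ℝ) : EReal) := by
  have hr : 0 < √δ := Real.sqrt_pos.2 hδ
  have hrR : √δ ≤ R := Real.sqrt_le_iff.2 ⟨hR.le, hδR⟩
  have hμ := smul_volume_restrict_le_of_rnDeriv measurableSet_Icc hdens
  -- The absolutely continuous part alone has mass at least 2aR. With √δ ≤ R this makes log(1/(a√δ))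
  -- nonnegative.
  have haR : a * (2 * R) ≤ 1 := by
    have h := hμ (Set.Icc (-R) R)
    rw [Measure.smul_apply, Measure.restrict_apply_self, Real.volume_Icc, smul_eq_mul,
      ← ENNReal.ofReal_mul ha.le] at h
    have := h.trans prob_le_one
    rw [ENNReal.ofReal_le_one] at this
    linarith
  have har : a * √δ ≤ 1 := by nlinarith
  have hL : 0 ≤ Real.log (1 / (a * √δ)) := Real.log_nonneg (by
    rw [le_div_iff₀ (by positivity)]
    linarith)
  have hlog : Real.log (1 / (a ^ 2 * δ)) = 2 * Real.log (1 / (a * √δ)) := by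
    have : 1 / (a ^ 2 * δ) = (1 / (a * √δ)) ^ 2 := by
      rw [div_pow, mul_pow, Real.sq_sqrt hδ.le, one_pow]
    rw [this, Real.log_pow]
    push_cast
    ring
  have H := isMollifiedDensity_mollifiedDensity ha hr hrR hsupp hμ
  have hsupp' : μ.map Neg.neg (Set.Icc (-R) R)ᶜ = 0 := by
    rw [Measure.map_apply measurable_neg measurableSet_Icc.compl, ← hsupp]
    congr 1
    ext x
    simp only [Set.mem_preimage, Set.mem_compl_iff, Set.mem_Icc, not_and_or, not_le]
    constructor <;> rintro (h | h) <;> first | (left; linarith) | (right; linarith)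
  have : IsProbabilityMeasure (μ.map Neg.neg) :=
    Measure.isProbabilityMeasure_map measurable_neg.aemeasurable
  have H' := isMollifiedDensity_mollifiedDensity ha hr hrR hsupp'
    (smul_volume_restrict_le_map_neg hμ)
  have hfun : mollifiedDensity (μ.map Neg.neg) √δ = fun x => mollifiedDensity μ √δ (-x) :=
    funext fun x => mollifiedDensity_map_neg μ √δ x
  rw [hfun] at H'
  have : IsProbabilityMeasure (gaussianConvolution μ δ) := by
    unfold gaussianConvolution
    infer_instance
  have hpm := H.continuous.measurable
  set L := Real.log (1 / (a * √δ)) with hLdef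
  have hLSI : SatisfiesLSI (gaussianConvolution μ δ)
      (5 * (4 * (18 * (R / a) + 66 * √δ ^ 2 + 11 * √δ ^ 2 * L))) := by
    refine satisfiesLSI_of_weighted_hardy (by positivity) fun f h hf hh hexp => ?_
    have hfc := (continuous_of_forall_absolutelyContinuousOnInterval hf).measurable
    have e : ∀ g : ℝ → ℝ, Measurable g →
        ∫⁻ x, ENNReal.ofReal (g x) ∂(gaussianConvolution μ δ) =
          ∫⁻ x, ENNReal.ofReal (g x * mollifiedDensity μ √δ x) := by
      intro g hg
      rw [gaussianConvolution_eq_withDensity μ hδ,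
        lintegral_withDensity_eq_lintegral_mul _ (by fun_prop) (by fun_prop)]
      refine lintegral_congr fun x => ?_
      rw [Pi.mul_apply, ← ENNReal.ofReal_mul (H.pos x).le, mul_comm]
    have hd := measurable_deriv f
    rw [e _ (by fun_prop)] at hexp
    rw [e _ (by fun_prop), e _ (by fun_prop)]
    exact lintegral_sq_sub_mul_weight_le H H' ha hR hr hL hh hexp hf
  refine (sInf_le (Set.mem_image_of_mem _ hLSI)).trans ?_
  rw [EReal.coe_le_coe_iff, hlog, Real.sq_sqrt hδ.le]
  have h1 : 0 < R / a := by positivity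
  have h2 : 0 ≤ δ * L := by positivity
  -- The constant obtained is 360 R/a + 1320 δ + 220 δL, and the logarithm in the statement equals
  -- 2L, so the stated coefficients leave ample room.
  nlinarith
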